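/- A real is an infinite binary sequence $X=X(0)X(1)X(2)\cdots$, and $X\restriction_n$ denotes its initial segment $X(0)\cdots X(n-1)$. For a set $U$ of finite binary strings, $\mu(U)$ denotes the uniform (Lebesgue) measure of the set $[U]$ of reals having a prefix in $U$. A Martin-Löf test is a uniformly c.e. sequence $(U_i)$ of sets of strings with $\mu(U_i)<2^{-i}$ for all $i$; a real $X$ is Martin-Löf random if $X\notin\bigcap_i [U_i]$ for every Martin-Löf test $(U_i)$. If an oracle Turing machine computes $X$ from an oracle $Y$ (on input $m$ it outputs $X(m)$), then the $Y$-use in the computation of $X\restriction_n$ is the least $k$ such that all positions of $Y$ queried during the computations of $X(0),\dots,X(n-1)$ are less than $k$. Given $f:\mathbb{N}\to\mathbb{N}$, a real $X$ is $f$-compressible if there are a real $Y$ and an oracle Turing machine that computes $X$ from $Y$ and queries, for each $n$, at most the first $f(n)$ digits of $Y$ in the computation of $X\restriction_n$. A real $X$ is Kobayashi incompressible if it is not $f$-compressible for any function $f:\mathbb{N}\to\mathbb{N}$ (computable or not) such that $n-f(n)$ is unbounded above. **Theorem (Kobayashi incompressibility and Turing reductions).** For every real $X$ the following are equivalent: (a)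 $X$ is Martin-Löf random; (b) for every real $Y$ with $X\leq_T Y$ and every oracle Turing machine computing $X$ from $Y$, there is a constant $c$ such that for all $n$ the $Y$-use in the computation of $X\restriction_n$ is at least $n-c$. Moreover, (a) and (b) hold if and only if $X$ is Kobayashi incompressible. -/

import Mathlib

open MeasureTheory
open scoped ENNReal

/-! ### Reals, strings, and Martin-Löf randomness

A *real* is an infinite binary sequence `X : ℕ → Bool`; a *string* is a `List Bool`. -/

/-- The initial segment `X ↾ n = X(0) X(1) ⋯ X(n - 1)`. -/
def restr (X : ℕ → Bool) (n : ℕ) : List Bool := (List.range n).map X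

/-- The open set of all reals that have a prefix in the set of strings `U`. -/
def openOf (U : Set (List Bool)) : Set (ℕ → Bool) := {X | ∃ n, restr X n ∈ U}

/-- The uniform (Lebesgue, fair-coin) probability measure on the space of reals. -/
noncomputable def coinMeasure : Measure (ℕ → Bool) :=
  Measure.infinitePi fun _ : ℕ => (PMF.uniformOfFintype Bool).toMeasure

/-- A Martin-Löf test: a uniformly c.e. sequence of sets of strings `U i` such that the open set
generated by `U i` has measure less than `2 ^ (-i)`. -/
structure IsMLTest (U : ℕ → Set (List Bool)) : Prop where
  uniformly_ce : REPred fun p : ℕ × List Bool => p.2 ∈ U p.1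
  measure_lt : ∀ i, coinMeasure (openOf (U i)) < (2 : ℝ≥0∞)⁻¹ ^ i

/-- `X` is Martin-Löf random if no Martin-Löf test captures it. -/
def MartinLofRandom (X : ℕ → Bool) : Prop :=
  ∀ U : ℕ → Set (List Bool), IsMLTest U → X ∉ ⋂ i, openOf (U i)

/-! ### Oracle machines and their oracle-use -/

/-- Programs of oracle machines: the programs of partial recursive functions, together with the
instruction `oracle`, which queries the oracle at the position given by its input. -/
inductive OracleCode : Type
  | zero : OracleCode
  | succ : OracleCode
  | left : OracleCode
  | right : OracleCode
  | oracle : OracleCode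
  | pair : OracleCode → OracleCode → OracleCode
  | comp : OracleCode → OracleCode → OracleCode
  | prec : OracleCode → OracleCode → OracleCode
  | rfind : OracleCode → OracleCode

namespace OracleCode

/-- `run Y e n` executes the program `e` on input `n` with oracle `Y`. If the execution halts, its
result is a pair `(y, u)`, where `y` is the output and `u` is the number of initial digits of `Y`
that contain all the queries: `u = q + 1` if `q` is the largest position of `Y` that was queried
during the execution, and `u = 0` if there was no query. -/
def run (Y : ℕ → Bool) : OracleCode → ℕ → Part (ℕ × ℕ)
  | zero => fun _ => Part.some (0, 0)
  | succ => fun n => Part.some (n + 1, 0)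
  | left => fun n => Part.some (n.unpair.1, 0)
  | right => fun n => Part.some (n.unpair.2, 0)
  | oracle => fun q => Part.some ((Y q).toNat, q + 1)
  | pair f g => fun n =>
      (run Y f n).bind fun r => (run Y g n).bind fun s =>
        Part.some (Nat.pair r.1 s.1, max r.2 s.2)
  | comp f g => fun n =>
      (run Y g n).bind fun r => (run Y f r.1).bind fun s => Part.some (s.1, max r.2 s.2)
  | prec f g => fun p =>
      Nat.rec (run Y f p.unpair.1)
        (fun k IH => IH.bind fun r =>
          (run Y g (Nat.pair p.unpair.1 (Nat.pair k r.1))).bind fun s =>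
            Part.some (s.1, max r.2 s.2))
        p.unpair.2
  | rfind f => fun a =>
      -- the least zero `m`, and the queries made while evaluating at `0, 1, …, m`
      (Nat.rfind fun k => (run Y f (Nat.pair a k)).map fun r => decide (r.1 = 0)).bind fun m =>
        (Nat.rec (Part.some 0)
          (fun k IH => IH.bind fun u =>
            (run Y f (Nat.pair a k)).bind fun r => Part.some (max u r.2))
          (m + 1) : Part ℕ).bind fun u => Part.some (m, u)

/-- The program `e` computes the real `X` from the oracle `Y` with oracle-use `u`: for each `n`,
on input `n` it halts with output `X(n)`, and the queries in this computation are contained in the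
first `u n` digits of `Y`, where `u n` is least possible. -/
def ComputesWithUse (e : OracleCode) (Y X : ℕ → Bool) (u : ℕ → ℕ) : Prop :=
  ∀ n, ((X n).toNat, u n) ∈ run Y e n

/-- The function computed with oracle `Y`, disregarding the oracle-use. -/
def eval (Y : ℕ → Bool) (e : OracleCode) (n : ℕ) : Part ℕ := (run Y e n).map Prod.fst

end OracleCode

/-- If `u n` is the oracle-use in the computation of the digit `X(n)`, then `prefixUse u n` is the
oracle-use in the computation of `X ↾ n`, that is, of the digits `X(0), …, X(n - 1)`. -/
def prefixUse (u : ℕ → ℕ) (n : ℕ) : ℕ := (Finset.range n).sup u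

/-- `X` is `f`-compressible: some oracle `Y` computes `X` through an oracle machine that queries,
for each `n`, at most the first `f n` digits of `Y` for the computation of `X ↾ n`. -/
def Compressible (f : ℕ → ℕ) (X : ℕ → Bool) : Prop :=
  ∃ (Y : ℕ → Bool) (e : OracleCode) (u : ℕ → ℕ),
    e.ComputesWithUse Y X u ∧ ∀ n, prefixUse u n ≤ f n

/-- `X` is Kobayashi incompressible: it is not `f`-compressible for any function `f` such that
`n - f n` is unbounded (above). -/
def KobayashiIncompressible (X : ℕ → Bool) : Prop :=
  ∀ f : ℕ → ℕ, ¬ BddAbove (Set.range fun n : ℕ => (n : ℤ) - (f n : ℤ)) → ¬ Compressible f X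

/-! ### The programs compute exactly the functions that are recursive in the oracle -/

namespace OracleCode

theorem eval_pair (Y : ℕ → Bool) (f g : OracleCode) :
    eval Y (pair f g) = fun n => (Nat.pair <$> eval Y f n <*> eval Y g n) := by
  funext n
  ext y
  simp [eval, run, Part.bind_map, Seq.seq]
  grind

theorem eval_comp (Y : ℕ → Bool) (f g : OracleCode) :
    eval Y (comp f g) = fun n => eval Y g n >>= eval Y f := by
  funext n
  ext y
  simp [eval, run]

theorem eval_prim_rec (Y : ℕ → Bool) (f g : OracleCode) :
    eval Y (prec f g) = fun p =>
      let (a, n) := Nat.unpair p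
      n.rec (eval Y f a) (fun y IH => do
        let i ← IH
        eval Y g (Nat.pair a (Nat.pair y i))) := by
  funext p
  simp only [eval, run]
  generalize p.unpair.1 = a
  generalize p.unpair.2 = n
  induction n with
  | zero => rfl
  | succ n ih =>
    simp only [← ih]
    ext y
    simp

theorem eval_rfind (Y : ℕ → Bool) (f : OracleCode) :
    eval Y (rfind f) = fun a =>
      Nat.rfind fun n => (fun m => decide (m = 0)) <$> eval Y f (Nat.pair a n) := by
  funext a
  have key : ∀ m : ℕ, (∀ k < m, (run Y f (Nat.pair a k)).Dom) →
      (Nat.rec (Part.some 0)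
          (fun k IH => IH.bind fun u =>
            (run Y f (Nat.pair a k)).bind fun r => Part.some (max u r.2))
          m : Part ℕ).Dom := by
    intro m
    induction m with
    | zero => intro _; trivial
    | succ m ih =>
      intro h
      have h1 := ih fun k hk => h k (by omega)
      exact ⟨h1, h m (by omega), trivial⟩
  have hE : (Nat.rfind fun n => (fun m => decide (m = 0)) <$> eval Y f (Nat.pair a n)) =
      Nat.rfind fun k => (run Y f (Nat.pair a k)).map fun r => decide (r.1 = 0) := by
    simp [eval, Part.map_map, Function.comp_def]
  rw [hE]
  ext y
  constructor
  · intro hy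
    obtain ⟨_, h1, rfl⟩ := (Part.mem_map_iff _).1 hy
    obtain ⟨m, hm, h2⟩ := Part.mem_bind_iff.1 h1
    obtain ⟨u, -, h3⟩ := Part.mem_bind_iff.1 h2
    obtain rfl := Part.mem_some_iff.1 h3
    exact hm
  · intro hy
    have hd : ∀ k < y + 1, (run Y f (Nat.pair a k)).Dom := by
      intro k hk
      rcases Nat.lt_succ_iff_lt_or_eq.1 hk with h | rfl
      · obtain ⟨r, hr, -⟩ := (Part.mem_map_iff _).1 (Nat.rfind_min hy h)
        exact Part.dom_iff_mem.2 ⟨r, hr⟩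
      · obtain ⟨r, hr, -⟩ := (Part.mem_map_iff _).1 (Nat.rfind_spec hy)
        exact Part.dom_iff_mem.2 ⟨r, hr⟩
    exact (Part.mem_map_iff _).2 ⟨_, Part.mem_bind_iff.2 ⟨y, hy,
      Part.mem_bind_iff.2 ⟨_, Part.get_mem (key _ hd), Part.mem_some _⟩⟩, rfl⟩

theorem recursiveIn_iff (Y : ℕ → Bool) (f : ℕ →. ℕ) :
    Nat.RecursiveIn {fun n => Part.some (Y n).toNat} f ↔ ∃ e, eval Y e = f := by
  constructor
  · intro h
    induction h with
    | zero => exact ⟨zero, by funext n; simp [eval, run]; rfl⟩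
    | succ => exact ⟨succ, by funext n; simp [eval, run]⟩
    | left => exact ⟨left, by funext n; simp [eval, run]⟩
    | right => exact ⟨right, by funext n; simp [eval, run]⟩
    | oracle g hg =>
      obtain rfl := Set.mem_singleton_iff.1 hg
      exact ⟨oracle, by funext n; simp [eval, run]⟩
    | pair _ _ hf hg =>
      obtain ⟨cf, rfl⟩ := hf
      obtain ⟨cg, rfl⟩ := hg
      exact ⟨pair cf cg, eval_pair _ _ _⟩
    | comp _ _ hf hg =>
      obtain ⟨cf, rfl⟩ := hf
      obtain ⟨cg, rfl⟩ := hg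
      exact ⟨comp cf cg, eval_comp _ _ _⟩
    | prec _ _ hf hg =>
      obtain ⟨cf, rfl⟩ := hf
      obtain ⟨cg, rfl⟩ := hg
      exact ⟨prec cf cg, eval_prim_rec _ _ _⟩
    | rfind _ hf =>
      obtain ⟨cf, rfl⟩ := hf
      exact ⟨rfind cf, eval_rfind _ _⟩
  · rintro ⟨e, rfl⟩
    induction e with
    | zero => exact Nat.RecursiveIn.zero.of_eq fun n => by simp [eval, run]; rfl
    | succ => exact Nat.RecursiveIn.succ.of_eq fun n => by simp [eval, run]
    | left => exact Nat.RecursiveIn.left.of_eq fun n => by simp [eval, run]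
    | right => exact Nat.RecursiveIn.right.of_eq fun n => by simp [eval, run]
    | oracle =>
      refine (Nat.RecursiveIn.oracle _ (Set.mem_singleton _)).of_eq fun n => ?_
      simp [eval, run]
    | pair _ _ hf hg => rw [eval_pair]; exact hf.pair hg
    | comp _ _ hf hg => rw [eval_comp]; exact hf.comp hg
    | prec _ _ hf hg => rw [eval_prim_rec]; exact hf.prec hg
    | rfind _ hf => rw [eval_rfind]; exact hf.rfind

/-- `X ≤_T Y` if and only if some program computes `X` from `Y`. -/
theorem turingReducible_iff (X Y : ℕ → Bool) :
    TuringReducible (fun n => Part.some (X n).toNat) (fun n => Part.some (Y n).toNat) ↔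
      ∃ e u, ComputesWithUse e Y X u := by
  refine RecursiveIn.iff_nat.trans ((recursiveIn_iff Y _).trans ?_)
  refine exists_congr fun e => ⟨fun h => ?_, ?_⟩
  · have h1 : ∀ n, ∃ u, ((X n).toNat, u) ∈ run Y e n := by
      intro n
      have h2 : (X n).toNat ∈ eval Y e n := by rw [h]; exact Part.mem_some _
      simpa [eval] using h2
    choose u hu using h1
    exact ⟨u, hu⟩
  · rintro ⟨u, hu⟩
    funext n
    exact Part.eq_some_iff.2 ((Part.mem_map_iff _).2 ⟨_, hu n, rfl⟩)

/-- The oracle-use of a program that computes `X` from `Y` is uniquely determined. -/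
theorem ComputesWithUse.use_unique {e : OracleCode} {Y X : ℕ → Bool} {u v : ℕ → ℕ}
    (hu : e.ComputesWithUse Y X u) (hv : e.ComputesWithUse Y X v) : u = v := by
  funext n
  exact congrArg Prod.snd (Part.mem_unique (hu n) (hv n))

end OracleCode

/-!
A real whose oracle-use can be compressed is caught by a test, and a real caught by a test can be
computed with compressed use.

*Random implies incompressible.* Fix a program `e`. The strings of length `|τ| + c + 1` that `e`
computes from a finite oracle `τ`, without querying beyond `τ`, form a c.e. set
(`OracleCode.rePred_compressedBy`). By the use principle (`OracleCode.run_congr`), an extension of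
`τ` only produces extensions of what `τ` produces. So the open set is already covered by what the
minimal strings `τ` produce; their cylinders are disjoint, and the measure is at most
`2 ^ (-(c + 1))` (`OracleCode.coinMeasure_compressedBy_le`). If the use in the computation of `X`
from `Y` falls below `n - c` for every `c`, then `X` is captured by this test.

*Incompressible implies random.* Let `X` be captured by a test `U`. Postponing each enumeration to
longer strings, one may list, primitive recursively in `i` and `n`, a finite set of words of length
`n` such that the words for `i`, taken over all `n`, have disjoint cylinders with union the open set
of `U i`. Since that set has measure less than `2 ^ (-i)`, the Kraft inequality
(`kraft_newWords`) yields a prefix code that assigns `n - i` bits to a word of length `n`. The code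
is canonical, that is, code words of each length form an interval which follows the shorter ones,
so a decoder that reads one bit per level only has to remember its offset from the start of that
interval. Let `X` be cut into blocks: a block that starts at `i` ends at the `n > i` at which `X ↾ n`
is a word for `i`, and the next block starts at `n + 1`. The oracle `Y` is the concatenation of the
codes of the blocks (`BlockCode.exists_decoder_eq`). Each block ends at a level where no bit is
read, so at the end of the block with number `k` (counting from `0`) only `n - k` bits have been
read when `X ↾ n` is known. The decoder is a primitive recursive state machine, and
`OracleCode.exists_run_of_machine` turns it into an oracle program with the same queries.

Kobayashi incompressibility is the lower bound on the use by definition, applied to the function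
`f = prefixUse u`.
-/

/-! ### Primitive recursive approximations -/

section Approximation

variable {α β σ : Type*} [Primcodable α] [Primcodable β] [Primcodable σ]

/-- A partial recursive function is the limit of primitive recursive approximations, which only
change from undefined to defined. -/
theorem Partrec.exists_primrec_approx {f : α →. σ} (hf : Partrec f) :
    ∃ H : ℕ → α → Option σ, Primrec₂ H ∧
      (∀ s t a y, s ≤ t → y ∈ H s a → y ∈ H t a) ∧ ∀ a y, y ∈ f a ↔ ∃ s, y ∈ H s a := by
  obtain ⟨c, hc⟩ := Nat.Partrec.Code.exists_code.1 hf
  have key : ∀ a y,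
      Encodable.encode y ∈ Nat.Partrec.Code.eval c (Encodable.encode a) ↔ y ∈ f a := by
    intro a y
    rw [hc]
    simp [Encodable.encodek]
  have key' : ∀ a n, n ∈ Nat.Partrec.Code.eval c (Encodable.encode a) →
      ∃ y, y ∈ f a ∧ n = Encodable.encode y := by
    intro a n
    rw [hc]
    simp only [Encodable.encodek, Part.coe_some, Part.bind_some, Part.mem_map_iff]
    rintro ⟨y, hy, rfl⟩
    exact ⟨y, hy, rfl⟩
  refine ⟨fun s a => (Nat.Partrec.Code.evaln s c (Encodable.encode a)).bind Encodable.decode,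
    ?_, ?_, ?_⟩
  · refine Primrec.option_bind ?_ (Primrec.decode.comp₂ Primrec₂.right)
    exact Nat.Partrec.Code.primrec_evaln.comp
      ((Primrec.fst.pair (Primrec.const c)).pair (Primrec.encode.comp Primrec.snd))
  · intro s t a y hst hy
    obtain ⟨n, hn, hy⟩ := Option.mem_bind_iff.1 hy
    exact Option.mem_bind_iff.2 ⟨n, Nat.Partrec.Code.evaln_mono hst hn, hy⟩
  · intro a y
    constructor
    · intro h
      obtain ⟨s, hs⟩ := Nat.Partrec.Code.evaln_complete.1 ((key a y).2 h)
      exact ⟨s, Option.mem_bind_iff.2 ⟨_, hs, Encodable.encodek y⟩⟩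
    · rintro ⟨s, hs⟩
      obtain ⟨n, hn, hy⟩ := Option.mem_bind_iff.1 hs
      obtain ⟨z, hz, rfl⟩ := key' a n (Nat.Partrec.Code.evaln_sound hn)
      rw [Encodable.encodek] at hy
      obtain rfl := Option.mem_some_iff.1 hy
      exact hz

theorem REPred.exists_primrecRel {p : α → Prop} (hp : REPred p) :
    ∃ R : ℕ → α → Prop, PrimrecRel R ∧
      (∀ s t a, s ≤ t → R s a → R t a) ∧ ∀ a, p a ↔ ∃ s, R s a := by
  obtain ⟨H, hH, hmono, hspec⟩ := Partrec.exists_primrec_approx hp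
  refine ⟨fun s a => () ∈ H s a, ?_, fun s t a hst h => hmono s t a () hst h, fun a => ?_⟩
  · exact Primrec.eq.comp hH (Primrec.const (some ()))
  · rw [← hspec]
    simp

theorem PrimrecRel.rePred_exists {R : α → β → Prop} (hR : PrimrecRel R) :
    REPred fun a => ∃ b, R a b := by
  classical
  have h1 : Primrec fun x : α × ℕ => ((Encodable.decode x.2 : Option β).map
      fun b => decide (R x.1 b)).getD false := by
    refine Primrec.option_getD.comp (Primrec.option_map (Primrec.decode.comp Primrec.snd) ?_)
      (Primrec.const false)
    exact hR.decide.comp (Primrec.fst.comp Primrec.fst) Primrec.snd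
  have h2 : Partrec fun a : α => Nat.rfind fun n => (Part.some (((Encodable.decode n : Option β).map
      fun b => decide (R a b)).getD false) : Part Bool) :=
    Partrec.rfind (p := fun a n => (Part.some (((Encodable.decode n : Option β).map
      fun b => decide (R a b)).getD false) : Part Bool)) h1.to_comp
  refine h2.dom_re.of_eq fun a => ?_
  refine Nat.rfind_dom'.trans ?_
  constructor
  · rintro ⟨n, hn, -⟩
    rw [Part.mem_some_iff] at hn
    cases hd : (Encodable.decode n : Option β) with
    | none => simp [hd] at hn
    | some b => exact ⟨b, by simpa [hd] using hn⟩
  · rintro ⟨b, hb⟩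
    exact ⟨Encodable.encode b, by simp [Encodable.encodek, hb], fun _ => trivial⟩

end Approximation

/-! ### Oracle programs -/

namespace OracleCode

/-- The use principle: an execution depends only on the digits below its oracle-use. -/
theorem run_congr {Y Z : ℕ → Bool} (e : OracleCode) :
    ∀ {n : ℕ} {r : ℕ × ℕ}, r ∈ run Y e n → (∀ j < r.2, Y j = Z j) → r ∈ run Z e n := by
  induction e with
  | zero => intro n r h _; exact h
  | succ => intro n r h _; exact h
  | left => intro n r h _; exact h
  | right => intro n r h _; exact h
  | oracle =>
    intro n r h hYZ
    obtain rfl := Part.mem_some_iff.1 h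
    exact Part.mem_some_iff.2 (by rw [hYZ n (Nat.lt_succ_self n)])
  | pair f g hf hg =>
    intro n r h hYZ
    obtain ⟨a, ha, h⟩ := Part.mem_bind_iff.1 h
    obtain ⟨b, hb, h⟩ := Part.mem_bind_iff.1 h
    obtain rfl := Part.mem_some_iff.1 h
    exact Part.mem_bind_iff.2 ⟨a, hf ha fun j hj => hYZ j (lt_max_of_lt_left hj),
      Part.mem_bind_iff.2 ⟨b, hg hb fun j hj => hYZ j (lt_max_of_lt_right hj), Part.mem_some _⟩⟩
  | comp f g hf hg =>
    intro n r h hYZ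
    obtain ⟨a, ha, h⟩ := Part.mem_bind_iff.1 h
    obtain ⟨b, hb, h⟩ := Part.mem_bind_iff.1 h
    obtain rfl := Part.mem_some_iff.1 h
    exact Part.mem_bind_iff.2 ⟨a, hg ha fun j hj => hYZ j (lt_max_of_lt_left hj),
      Part.mem_bind_iff.2 ⟨b, hf hb fun j hj => hYZ j (lt_max_of_lt_right hj), Part.mem_some _⟩⟩
  | prec f g hf hg =>
    intro n r h hYZ
    simp only [run] at h ⊢
    generalize n.unpair.1 = a at h ⊢
    generalize n.unpair.2 = k at h ⊢
    induction k generalizing r with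
    | zero => exact hf h hYZ
    | succ k ih =>
      obtain ⟨s, hs, h⟩ := Part.mem_bind_iff.1 h
      obtain ⟨b, hb, h⟩ := Part.mem_bind_iff.1 h
      obtain rfl := Part.mem_some_iff.1 h
      exact Part.mem_bind_iff.2 ⟨s, ih (fun j hj => hYZ j (lt_max_of_lt_left hj)) hs,
        Part.mem_bind_iff.2 ⟨b, hg hb fun j hj => hYZ j (lt_max_of_lt_right hj), Part.mem_some _⟩⟩
  | rfind f hf =>
    intro a r h hYZ
    simp only [run] at h ⊢
    obtain ⟨m, hm, h⟩ := Part.mem_bind_iff.1 h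
    obtain ⟨u, hu, h⟩ := Part.mem_bind_iff.1 h
    obtain rfl := Part.mem_some_iff.1 h
    -- the loop that collects the uses agrees for both oracles, and so does every evaluation in it
    have key : ∀ k u, u ∈ (Nat.rec (Part.some 0)
          (fun k IH => IH.bind fun u =>
            (run Y f (Nat.pair a k)).bind fun r => Part.some (max u r.2)) k : Part ℕ) →
        (∀ j < u, Y j = Z j) →
        u ∈ (Nat.rec (Part.some 0)
          (fun k IH => IH.bind fun u =>
            (run Z f (Nat.pair a k)).bind fun r => Part.some (max u r.2)) k : Part ℕ) ∧
        ∀ l < k, ∃ r, r ∈ run Y f (Nat.pair a l) ∧ r ∈ run Z f (Nat.pair a l) := by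
      intro k
      induction k with
      | zero => exact fun u hu _ => ⟨hu, fun l hl => absurd hl (Nat.not_lt_zero l)⟩
      | succ k ih =>
        intro u hu huYZ
        obtain ⟨s, hs, h⟩ := Part.mem_bind_iff.1 hu
        obtain ⟨b, hb, h⟩ := Part.mem_bind_iff.1 h
        obtain rfl := Part.mem_some_iff.1 h
        obtain ⟨h1, h2⟩ := ih s hs fun j hj => huYZ j (lt_max_of_lt_left hj)
        have h3 := hf hb fun j hj => huYZ j (lt_max_of_lt_right hj)
        refine ⟨Part.mem_bind_iff.2 ⟨s, h1, Part.mem_bind_iff.2 ⟨b, h3, Part.mem_some _⟩⟩, ?_⟩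
        intro l hl
        rcases Nat.lt_succ_iff_lt_or_eq.1 hl with hl | rfl
        · exact h2 l hl
        · exact ⟨b, hb, h3⟩
    obtain ⟨h1, h2⟩ := key (m + 1) u hu hYZ
    refine Part.mem_bind_iff.2 ⟨m, ?_, Part.mem_bind_iff.2 ⟨u, h1, Part.mem_some _⟩⟩
    have transfer : ∀ l < m + 1, ∀ b,
        b ∈ (run Y f (Nat.pair a l)).map (fun r => decide (r.1 = 0)) →
        b ∈ (run Z f (Nat.pair a l)).map (fun r => decide (r.1 = 0)) := by
      intro l hl b hb
      obtain ⟨r, hr, hr'⟩ := h2 l hl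
      obtain ⟨q, hq, rfl⟩ := (Part.mem_map_iff _).1 hb
      obtain rfl := Part.mem_unique hr hq
      exact (Part.mem_map_iff _).2 ⟨r, hr', rfl⟩
    exact Nat.mem_rfind.2 ⟨transfer m (Nat.lt_succ_self m) _ (Nat.rfind_spec hm),
      fun {l} hl => transfer l (Nat.lt_succ_of_lt hl) _ (Nat.rfind_min hm hl)⟩

/-- A finite string as an oracle, continued by zeros. -/
def padded (τ : List Bool) (k : ℕ) : Bool := τ.getD k false

/-- The search performed by `rfind`, with its record of the uses, for an evaluation function that
depends on a parameter. -/
theorem partrec_rfind_use {γ : Type*} [Primcodable γ] {R : γ → ℕ →. ℕ × ℕ}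
    (hR : Partrec fun x : γ × ℕ => R x.1 x.2) :
    Partrec fun x : γ × ℕ =>
      (Nat.rfind fun k => (R x.1 (Nat.pair x.2 k)).map fun r => decide (r.1 = 0)).bind fun m =>
        (Nat.rec (Part.some 0)
          (fun k IH => IH.bind fun u =>
            (R x.1 (Nat.pair x.2 k)).bind fun r => Part.some (max u r.2))
          (m + 1) : Part ℕ).bind fun u => Part.some (m, u) := by
  have hmax : Computable₂ (max : ℕ → ℕ → ℕ) := Primrec.nat_max.to_comp
  have hpair : Computable₂ Nat.pair := Primrec₂.natPair.to_comp
  have hfind : Partrec fun x : γ × ℕ => Nat.rfind fun k =>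
      (R x.1 (Nat.pair x.2 k)).map fun r => decide (r.1 = 0) := by
    refine Partrec.rfind (Partrec.map (hR.comp ((Computable.fst.comp Computable.fst).pair
      (hpair.comp (Computable.snd.comp Computable.fst) Computable.snd))) ?_)
    exact ((Primrec.eq.comp (Primrec.fst.comp Primrec.snd) (Primrec.const 0)).decide).to_comp
  have harg : Computable fun y : ((γ × ℕ) × ℕ) × (ℕ × ℕ) =>
      (y.1.1.1, Nat.pair y.1.1.2 y.2.1) :=
    (Computable.fst.comp (Computable.fst.comp Computable.fst)).pair
      (hpair.comp (Computable.snd.comp (Computable.fst.comp Computable.fst))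
        (Computable.fst.comp Computable.snd))
  have hrun : Partrec fun y : ((γ × ℕ) × ℕ) × (ℕ × ℕ) =>
      R y.1.1.1 (Nat.pair y.1.1.2 y.2.1) := hR.comp harg
  have hm : Computable fun y : (((γ × ℕ) × ℕ) × (ℕ × ℕ)) × (ℕ × ℕ) =>
      max y.1.2.2 y.2.2 :=
    hmax.comp (Computable.snd.comp (Computable.snd.comp Computable.fst))
      (Computable.snd.comp Computable.snd)
  have hstep : Partrec₂ fun (x : (γ × ℕ) × ℕ) (p : ℕ × ℕ) =>
      (R x.1.1 (Nat.pair x.1.2 p.1)).bind fun r => Part.some (max p.2 r.2) :=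
    Partrec.bind hrun hm.partrec
  have hloop : Partrec fun x : (γ × ℕ) × ℕ =>
      (Nat.rec (Part.some 0)
        (fun k IH => IH.bind fun u =>
          (R x.1.1 (Nat.pair x.1.2 k)).bind fun r => Part.some (max u r.2))
        (x.2 + 1) : Part ℕ) :=
    Partrec.nat_rec (Computable.succ.comp Computable.snd) (Computable.const 0).partrec hstep
  exact Partrec.bind hfind (Partrec.bind hloop
    ((Computable.snd.comp Computable.fst).pair Computable.snd).partrec)

/-- Running a fixed program is partial recursive, uniformly in a finite oracle. -/
theorem partrec_run_padded (e : OracleCode) :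
    Partrec fun x : List Bool × ℕ => run (padded x.1) e x.2 := by
  have hmax : Computable₂ (max : ℕ → ℕ → ℕ) := Primrec.nat_max.to_comp
  have hpair : Computable₂ Nat.pair := Primrec₂.natPair.to_comp
  induction e with
  | zero => exact (Computable.const (0, 0)).partrec
  | succ =>
    exact ((Computable.succ.comp Computable.snd).pair (Computable.const 0)).partrec
  | left =>
    exact ((Computable.fst.comp (Computable.unpair.comp Computable.snd)).pair
      (Computable.const 0)).partrec
  | right =>
    exact ((Computable.snd.comp (Computable.unpair.comp Computable.snd)).pair
      (Computable.const 0)).partrec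
  | oracle =>
    refine Computable.partrec (Computable.pair ?_ (Computable.succ.comp Computable.snd))
    exact ((Primrec.dom_bool Bool.toNat).comp (Primrec.list_getD false)).to_comp
  | pair f g hf hg =>
    refine Partrec.bind hf (Partrec.bind (hg.comp Computable.fst) ?_)
    refine Computable.partrec (Computable.pair ?_ ?_)
    · exact hpair.comp (Computable.fst.comp (Computable.snd.comp Computable.fst))
        (Computable.fst.comp Computable.snd)
    · exact hmax.comp (Computable.snd.comp (Computable.snd.comp Computable.fst))
        (Computable.snd.comp Computable.snd)
  | comp f g hf hg =>
    refine Partrec.bind hg (Partrec.bind (hf.comp ((Computable.fst.comp Computable.fst).pair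
      (Computable.fst.comp Computable.snd))) ?_)
    refine Computable.partrec (Computable.pair (Computable.fst.comp Computable.snd) ?_)
    exact hmax.comp (Computable.snd.comp (Computable.snd.comp Computable.fst))
      (Computable.snd.comp Computable.snd)
  | prec f g hf hg =>
    have hun : Computable fun x : List Bool × ℕ => x.2.unpair :=
      Computable.unpair.comp Computable.snd
    have harg : Computable fun y : (List Bool × ℕ) × (ℕ × (ℕ × ℕ)) =>
        (y.1.1, Nat.pair y.1.2.unpair.1 (Nat.pair y.2.1 y.2.2.1)) :=
      (Computable.fst.comp Computable.fst).pair
        (hpair.comp (Computable.fst.comp (hun.comp Computable.fst))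
          (hpair.comp (Computable.fst.comp Computable.snd)
            (Computable.fst.comp (Computable.snd.comp Computable.snd))))
    have hstep : Partrec₂ fun (x : List Bool × ℕ) (p : ℕ × (ℕ × ℕ)) =>
        (run (padded x.1) g (Nat.pair x.2.unpair.1 (Nat.pair p.1 p.2.1))).bind
          fun s => Part.some (s.1, max p.2.2 s.2) := by
      refine Partrec.bind (hg.comp harg) ?_
      refine Computable.partrec (Computable.pair (Computable.fst.comp Computable.snd) ?_)
      exact hmax.comp (Computable.snd.comp (Computable.snd.comp
        (Computable.snd.comp Computable.fst))) (Computable.snd.comp Computable.snd)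
    exact Partrec.nat_rec (Computable.snd.comp hun)
      (hf.comp (Computable.fst.pair (Computable.fst.comp hun))) hstep
  | rfind f hf =>
    exact partrec_rfind_use (R := fun τ n => run (padded τ) f n) hf

/-- Primitive recursive functions have programs that never query the oracle. -/
theorem exists_run_eq_of_primrec {f : ℕ → ℕ} (hf : Nat.Primrec f) :
    ∃ e, ∀ Y n, run Y e n = Part.some (f n, 0) := by
  induction hf with
  | zero => exact ⟨zero, fun _ _ => rfl⟩
  | succ => exact ⟨succ, fun _ _ => rfl⟩
  | left => exact ⟨left, fun _ _ => rfl⟩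
  | right => exact ⟨right, fun _ _ => rfl⟩
  | pair _ _ hf hg =>
    obtain ⟨a, ha⟩ := hf
    obtain ⟨b, hb⟩ := hg
    exact ⟨pair a b, fun Y n => by simp [run, ha, hb]⟩
  | comp _ _ hf hg =>
    obtain ⟨a, ha⟩ := hf
    obtain ⟨b, hb⟩ := hg
    exact ⟨comp a b, fun Y n => by simp [run, ha, hb]⟩
  | prec _ _ hf hg =>
    obtain ⟨a, ha⟩ := hf
    obtain ⟨b, hb⟩ := hg
    refine ⟨prec a b, fun Y n => ?_⟩
    simp only [run, Nat.unpaired, ha, hb]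
    induction n.unpair.2 with
    | zero => rfl
    | succ k ih => exact (congrArg (fun P : Part (ℕ × ℕ) => P.bind _) ih).trans (by simp)

end OracleCode

/-! ### Strings and cylinders -/

theorem length_restr (X : ℕ → Bool) (n : ℕ) : (restr X n).length = n := by simp [restr]

theorem padded_restr (X : ℕ → Bool) {n j : ℕ} (hj : j < n) :
    OracleCode.padded (restr X n) j = X j := by
  simp [OracleCode.padded, restr, List.getD, hj]

theorem restr_eq_iff {X : ℕ → Bool} {σ : List Bool} :
    restr X σ.length = σ ↔ ∀ j < σ.length, X j = OracleCode.padded σ j := by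
  constructor
  · intro h j hj
    conv_rhs => rw [← h]
    rw [padded_restr X hj]
  · intro h
    refine List.ext_getElem (length_restr X _) fun j h1 h2 => ?_
    have := h j h2
    simpa [restr, OracleCode.padded, List.getD, h2] using this

theorem restr_eq_restr_iff {X Z : ℕ → Bool} {n : ℕ} :
    restr X n = restr Z n ↔ ∀ j < n, X j = Z j := by
  simp [restr]

theorem take_restr (X : ℕ → Bool) {m n : ℕ} (h : m ≤ n) : (restr X n).take m = restr X m := by
  simp [restr, ← List.map_take, List.take_range, h]

/-- The cylinder of all reals that extend the string `σ`. -/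
def cylinderOf (σ : List Bool) : Set (ℕ → Bool) := {X | restr X σ.length = σ}

theorem mem_cylinderOf {X : ℕ → Bool} {σ : List Bool} :
    X ∈ cylinderOf σ ↔ restr X σ.length = σ := Iff.rfl

theorem cylinderOf_eq_pi (σ : List Bool) :
    cylinderOf σ = Set.pi (Finset.range σ.length) fun j => {OracleCode.padded σ j} := by
  ext X
  simp [mem_cylinderOf, restr_eq_iff, Set.mem_pi]

theorem measurableSet_cylinderOf (σ : List Bool) : MeasurableSet (cylinderOf σ) := by
  rw [cylinderOf_eq_pi]
  exact MeasurableSet.pi (Finset.countable_toSet _) fun _ _ => MeasurableSet.singleton _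

instance : IsProbabilityMeasure coinMeasure := by
  unfold coinMeasure
  infer_instance

theorem coinMeasure_cylinderOf (σ : List Bool) :
    coinMeasure (cylinderOf σ) = (2 : ℝ≥0∞)⁻¹ ^ σ.length := by
  rw [cylinderOf_eq_pi, coinMeasure, Measure.infinitePi_pi _ fun _ _ => MeasurableSet.singleton _]
  simp

/-- Cylinders of strings neither of which properly extends the other are disjoint. -/
theorem disjoint_cylinderOf {σ τ : List Bool} (hne : σ ≠ τ)
    (hσ : ∀ k < σ.length, σ.take k ≠ τ) (hτ : ∀ k < τ.length, τ.take k ≠ σ) :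
    Disjoint (cylinderOf σ) (cylinderOf τ) := by
  rw [Set.disjoint_left]
  intro X h1 h2
  rw [mem_cylinderOf] at h1 h2
  rcases lt_trichotomy σ.length τ.length with h | h | h
  · apply hτ _ h
    rw [← h2, take_restr X h.le, h1]
  · exact hne (by rw [← h1, h, h2])
  · apply hσ _ h
    rw [← h1, take_restr X h.le, h2]

/-! ### The use of a random real is not compressed -/

namespace OracleCode

/-- With the string `τ` as its oracle, the program `e` computes the string `σ` without querying
positions beyond `τ`. -/
def Produces (e : OracleCode) (τ σ : List Bool) : Prop :=
  ∀ j < σ.length, ∃ u ≤ τ.length, ((padded σ j).toNat, u) ∈ run (padded τ) e j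

/-- The strings that `e` produces from a string shorter by `c + 1`. -/
def compressedBy (e : OracleCode) (c : ℕ) : Set (List Bool) :=
  {σ | ∃ τ : List Bool, σ.length = τ.length + c + 1 ∧ Produces e τ σ}

theorem rePred_compressedBy (e : OracleCode) :
    REPred fun p : ℕ × List Bool => p.2 ∈ compressedBy e p.1 := by
  obtain ⟨H, hH, hmono, hspec⟩ := Partrec.exists_primrec_approx (partrec_run_padded e)
  let G : ℕ → (List Bool × ℕ) × List Bool → Prop := fun j y =>
    (H y.1.2 (y.1.1, j)).map Prod.fst = some (padded y.2 j).toNat ∧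
      ((H y.1.2 (y.1.1, j)).map Prod.snd).getD (y.1.1.length + 1) ≤ y.1.1.length
  have hG : PrimrecRel G := by
    have hτ : Primrec fun x : ℕ × ((List Bool × ℕ) × List Bool) => x.2.1.1 :=
      Primrec.fst.comp (Primrec.fst.comp Primrec.snd)
    have hval : Primrec fun x : ℕ × ((List Bool × ℕ) × List Bool) => H x.2.1.2 (x.2.1.1, x.1) :=
      hH.comp (Primrec.snd.comp (Primrec.fst.comp Primrec.snd)) (hτ.pair Primrec.fst)
    have hlen := Primrec.list_length.comp hτ
    refine PrimrecPred.and (Primrec.eq.comp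
      (Primrec.option_map hval (Primrec.fst.comp Primrec.snd).to₂) (Primrec.option_some.comp ?_))
      (Primrec.nat_le.comp (Primrec.option_getD.comp
      (Primrec.option_map hval (Primrec.snd.comp Primrec.snd).to₂) (Primrec.succ.comp hlen)) hlen)
    exact (Primrec.dom_bool Bool.toNat).comp
      ((Primrec.list_getD false).comp (Primrec.snd.comp Primrec.snd) Primrec.fst)
  have hGiff : ∀ j s τ σ, G j ((τ, s), σ) ↔
      ∃ u ≤ τ.length, ((padded σ j).toNat, u) ∈ H s (τ, j) := by
    intro j s τ σ
    simp only [G, Option.mem_def]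
    cases H s (τ, j) with
    | none => simp
    | some r => simp [Prod.ext_iff, eq_comm, and_comm]
  have hR : PrimrecRel fun (p : ℕ × List Bool) (q : List Bool × ℕ) =>
      p.2.length = q.1.length + p.1 + 1 ∧ ∀ j < p.2.length, G j (q, p.2) := by
    have hlen : Primrec fun x : (ℕ × List Bool) × (List Bool × ℕ) => x.1.2.length :=
      Primrec.list_length.comp (Primrec.snd.comp Primrec.fst)
    refine PrimrecPred.and (Primrec.eq.comp hlen (Primrec.succ.comp (Primrec.nat_add.comp
      (Primrec.list_length.comp (Primrec.fst.comp Primrec.snd))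
      (Primrec.fst.comp Primrec.fst)))) ?_
    exact (hG.forall_mem_list.comp (Primrec.list_range.comp hlen)
      (Primrec.snd.pair (Primrec.snd.comp Primrec.fst))).of_eq fun _ => by simp
  refine hR.rePred_exists.of_eq fun ⟨c, σ⟩ => ?_
  constructor
  · rintro ⟨⟨τ, s⟩, hlen, h⟩
    refine ⟨τ, hlen, fun j hj => ?_⟩
    obtain ⟨u, hu, hmem⟩ := (hGiff j s τ σ).1 (h j hj)
    exact ⟨u, hu, (hspec (τ, j) _).2 ⟨s, hmem⟩⟩
  · rintro ⟨τ, hlen, h⟩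
    -- a common stage at which all the digits of `σ` have been computed
    have h1 : ∀ j, ∃ s, j < σ.length → ∃ u ≤ τ.length, ((padded σ j).toNat, u) ∈ H s (τ, j) := by
      intro j
      by_cases hj : j < σ.length
      · obtain ⟨u, hu, hmem⟩ := h j hj
        obtain ⟨s, hs⟩ := (hspec (τ, j) _).1 hmem
        exact ⟨s, fun _ => ⟨u, hu, hs⟩⟩
      · exact ⟨0, fun h => absurd h hj⟩
    choose s hs using h1
    refine ⟨(τ, (Finset.range σ.length).sup s), hlen, fun j hj => (hGiff _ _ _ _).2 ?_⟩
    obtain ⟨u, hu, hmem⟩ := hs j hj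
    exact ⟨u, hu, hmono _ _ _ _ (Finset.le_sup (Finset.mem_range.2 hj)) hmem⟩

/-- Longer oracle strings produce extensions of what shorter ones produce. -/
theorem Produces.padded_eq {e : OracleCode} {τ τ' σ σ' : List Bool} {k : ℕ}
    (hτ : τ' = τ.take k) (h' : Produces e τ' σ') (h : Produces e τ σ)
    {j : ℕ} (hj' : j < σ'.length) (hj : j < σ.length) : padded σ' j = padded σ j := by
  obtain ⟨u', hu', hr'⟩ := h' j hj'
  obtain ⟨u, -, hr⟩ := h j hj
  have hagree : ∀ i < u', padded τ' i = padded τ i := by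
    intro i hi
    have h1 : i < τ'.length := by omega
    subst hτ
    have h2 : i < k ∧ i < τ.length := by simpa using h1
    simp [padded, List.getD, h2.1]
  have := congrArg Prod.fst (Part.mem_unique (run_congr e hr' hagree) hr)
  generalize padded σ' j = a at this ⊢
  generalize padded σ j = b at this ⊢
  revert this
  cases a <;> cases b <;> simp

/-- The minimal strings `τ` that produce a string of length `|τ| + c + 1` suffice to cover, and they
form a prefix-free set. -/
theorem coinMeasure_compressedBy_le (e : OracleCode) (c : ℕ) :
    coinMeasure (openOf (compressedBy e c)) ≤ (2 : ℝ≥0∞)⁻¹ ^ (c + 1) := by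
  classical
  -- `M` consists of the minimal members of `D`
  let D : Set (List Bool) := {τ | ∃ σ : List Bool, σ.length = τ.length + c + 1 ∧ Produces e τ σ}
  let M : Set (List Bool) := {τ | τ ∈ D ∧ ∀ k < τ.length, τ.take k ∉ D}
  have hsel : ∀ τ : M, ∃ σ : List Bool, σ.length = τ.1.length + c + 1 ∧ Produces e τ.1 σ :=
    fun τ => τ.2.1
  choose out hlen hout using hsel
  have hsub : openOf (compressedBy e c) ⊆ ⋃ τ : M, cylinderOf (out τ) := by
    rintro X ⟨n, τ, hn, hτ⟩
    rw [length_restr] at hn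
    have hex : ∃ k, τ.take k ∈ D :=
      ⟨τ.length, by rw [List.take_length]; exact ⟨_, by rw [length_restr, hn], hτ⟩⟩
    have hk : Nat.find hex ≤ τ.length :=
      Nat.find_min' hex (by rw [List.take_length]; exact ⟨_, by rw [length_restr, hn], hτ⟩)
    have hmin : τ.take (Nat.find hex) ∈ M := by
      refine ⟨Nat.find_spec hex, fun k hk' => ?_⟩
      have hk'' : k < Nat.find hex := by
        rw [List.length_take] at hk'
        omega
      rw [List.take_take, min_eq_left hk''.le]
      exact Nat.find_min hex hk''
    refine Set.mem_iUnion.2 ⟨⟨_, hmin⟩, ?_⟩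
    rw [mem_cylinderOf, restr_eq_iff]
    intro j hj
    have hjn : j < n := by
      have h1 := hlen ⟨_, hmin⟩
      simp only [List.length_take] at h1
      omega
    rw [(hout ⟨_, hmin⟩).padded_eq rfl hτ hj (by rwa [length_restr]), padded_restr X hjn]
  have hdisj : Pairwise (Function.onFun Disjoint fun τ : M => cylinderOf τ.1) := by
    intro τ τ' hne
    exact disjoint_cylinderOf (fun h => hne (Subtype.ext h))
      (fun k hk h => τ.2.2 k hk (h ▸ τ'.2.1)) (fun k hk h => τ'.2.2 k hk (h ▸ τ.2.1))
  calc coinMeasure (openOf (compressedBy e c))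
      ≤ coinMeasure (⋃ τ : M, cylinderOf (out τ)) := measure_mono hsub
    _ ≤ ∑' τ : M, coinMeasure (cylinderOf (out τ)) := measure_iUnion_le _
    _ = ∑' τ : M, (2 : ℝ≥0∞)⁻¹ ^ (c + 1) * coinMeasure (cylinderOf τ.1) := by
        refine tsum_congr fun τ => ?_
        rw [coinMeasure_cylinderOf, coinMeasure_cylinderOf, hlen, ← pow_add]
        congr 1
        omega
    _ = (2 : ℝ≥0∞)⁻¹ ^ (c + 1) * coinMeasure (⋃ τ : M, cylinderOf τ.1) := by
        rw [ENNReal.tsum_mul_left, measure_iUnion hdisj fun τ => measurableSet_cylinderOf _]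
    _ ≤ (2 : ℝ≥0∞)⁻¹ ^ (c + 1) := mul_le_of_le_one_right' prob_le_one

theorem isMLTest_compressedBy (e : OracleCode) : IsMLTest (compressedBy e) where
  uniformly_ce := rePred_compressedBy e
  measure_lt c := by
    refine (coinMeasure_compressedBy_le e c).trans_lt ?_
    rw [pow_succ, ← div_eq_mul_inv]
    exact ENNReal.half_lt_self (by simp) (by simp)

end OracleCode

theorem MartinLofRandom.exists_le_prefixUse {X Y : ℕ → Bool} (hX : MartinLofRandom X)
    {e : OracleCode} {u : ℕ → ℕ} (hu : e.ComputesWithUse Y X u) :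
    ∃ c : ℕ, ∀ n : ℕ, (n : ℤ) - (c : ℤ) ≤ (prefixUse u n : ℤ) := by
  by_contra! hcon
  refine hX _ (OracleCode.isMLTest_compressedBy e) (Set.mem_iInter.2 fun c => ?_)
  obtain ⟨n, hn⟩ := hcon c
  set k := prefixUse u n with hk
  refine ⟨k + c + 1, restr Y k, by simp [length_restr], fun j hj => ?_⟩
  rw [length_restr] at hj
  have huj : u j ≤ k := Finset.le_sup (f := u) (Finset.mem_range.2 (by omega))
  refine ⟨u j, by rwa [length_restr], ?_⟩
  rw [padded_restr X hj]
  exact OracleCode.run_congr e (hu j) fun i hi => (padded_restr Y (by omega)).symm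

/-! ### Oracle programs from primitive recursive state machines -/

namespace OracleCode

/-- The states of a machine that in state `s` queries the oracle at position `query s` and
uses the answer to determine its next state. -/
def trajectory {S : Type*} (init : S) (query : S → ℕ) (step : S → Bool → S) (Y : ℕ → Bool) : ℕ → S
  | 0 => init
  | k + 1 =>
    step (trajectory init query step Y k) (Y (query (trajectory init query step Y k)))

variable {S : Type*} [Primcodable S]

/-- A program computes the `k`-th state of the machine, whatever the parameter `a`, with no use
beyond the positions queried in the first `k` steps. -/
theorem exists_run_trajectory (init : S) {query : S → ℕ} {step : S → Bool → S}
    (hquery : Primrec query) (hstep : Primrec₂ step) :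
    ∃ e, ∀ (Y : ℕ → Bool) (a k : ℕ), ∃ u,
      run Y e (Nat.pair a k) =
        Part.some (Encodable.encode (trajectory init query step Y k), u) ∧
      ∀ B, (∀ j < k, query (trajectory init query step Y j) < B) → u ≤ B := by
  have hs : Primrec fun x : ℕ => (Encodable.decode x.unpair.2.unpair.2 : Option S) :=
    Primrec.decode.comp (Primrec.snd.comp (Primrec.unpair.comp
      (Primrec.snd.comp Primrec.unpair)))
  have hQ : Primrec fun x : ℕ =>
      ((Encodable.decode x.unpair.2.unpair.2 : Option S).map query).getD 0 :=
    Primrec.option_getD.comp (Primrec.option_map hs (hquery.comp Primrec.snd).to₂)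
      (Primrec.const 0)
  have hG : Primrec fun x : ℕ => ((Encodable.decode x.unpair.1.unpair.2.unpair.2 : Option S).map
      fun s => Encodable.encode (step s (decide (x.unpair.2 = 1)))).getD 0 := by
    refine Primrec.option_getD.comp (Primrec.option_map
      (hs.comp (Primrec.fst.comp Primrec.unpair)) ?_) (Primrec.const 0)
    refine Primrec.encode.comp (hstep.comp Primrec.snd ?_)
    exact (Primrec.eq.comp (Primrec.snd.comp (Primrec.unpair.comp Primrec.fst))
      (Primrec.const 1)).decide
  obtain ⟨eI, hI⟩ := exists_run_eq_of_primrec (Nat.Primrec.const (Encodable.encode init))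
  obtain ⟨eid, hid⟩ := exists_run_eq_of_primrec Nat.Primrec.id
  obtain ⟨eQ, hQ⟩ := exists_run_eq_of_primrec (Primrec.nat_iff.1 hQ)
  obtain ⟨eG, hG⟩ := exists_run_eq_of_primrec (Primrec.nat_iff.1 hG)
  refine ⟨prec eI (comp eG (pair eid (comp oracle eQ))), fun Y a k => ?_⟩
  induction k with
  | zero => exact ⟨0, by simp [run, hI, trajectory], fun B _ => Nat.zero_le B⟩
  | succ k ih =>
    obtain ⟨u, hu, hB⟩ := ih
    refine ⟨max u (query (trajectory init query step Y k) + 1), ?_, fun B h => ?_⟩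
    · simp only [run, Nat.unpair_pair] at hu ⊢
      refine (congrArg (fun P : Part (ℕ × ℕ) => P.bind _) hu).trans ?_
      cases hb : Y (query (trajectory init query step Y k)) <;>
        simp [hid, hQ, hG, Encodable.encodek, trajectory, hb]
    · exact max_le (hB B fun j hj => h j (by omega)) (h k (Nat.lt_succ_self k))

/-- A primitive recursive state machine, run until it halts, is an oracle program; its use is
bounded by the positions which the machine queries before it halts. -/
theorem exists_run_of_machine (init : S) {query : S → ℕ} {step : S → Bool → S}
    {halt out : ℕ → S → Bool} (hquery : Primrec query) (hstep : Primrec₂ step)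
    (hhalt : Primrec₂ halt) (hout : Primrec₂ out) :
    ∃ e, ∀ (Y : ℕ → Bool) (m k : ℕ),
      halt m (trajectory init query step Y k) = true →
      (∀ j < k, halt m (trajectory init query step Y j) = false) →
      ∃ u, ((out m (trajectory init query step Y k)).toNat, u) ∈ run Y e m ∧
        ∀ B, (∀ j < k, query (trajectory init query step Y j) < B) → u ≤ B := by
  obtain ⟨eS, hS⟩ := exists_run_trajectory init hquery hstep
  have lift : ∀ {f : ℕ → S → Bool}, Primrec₂ f → ∃ e, ∀ (Y : ℕ → Bool) (m k : ℕ) (s : S),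
      run Y e (Nat.pair (Nat.pair m k) (Encodable.encode s)) = Part.some ((f m s).toNat, 0) := by
    intro f hf
    have h : Primrec fun x : ℕ => ((Encodable.decode x.unpair.2 : Option S).map
        fun s => (f x.unpair.1.unpair.1 s).toNat).getD 0 := by
      refine Primrec.option_getD.comp (Primrec.option_map
        (Primrec.decode.comp (Primrec.snd.comp Primrec.unpair)) ?_) (Primrec.const 0)
      refine (Primrec.dom_bool Bool.toNat).comp (hf.comp ?_ Primrec.snd)
      exact Primrec.fst.comp (Primrec.unpair.comp (Primrec.fst.comp
        (Primrec.unpair.comp Primrec.fst)))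
    obtain ⟨e, he⟩ := exists_run_eq_of_primrec (Primrec.nat_iff.1 h)
    exact ⟨e, fun Y m k s => by simp [he, Encodable.encodek]⟩
  obtain ⟨eH, hH⟩ := lift (f := fun m s => !halt m s) (Primrec.not.comp hhalt)
  obtain ⟨eO, hO⟩ := lift hout
  obtain ⟨eid, hid⟩ := exists_run_eq_of_primrec Nat.Primrec.id
  refine ⟨comp (comp eO (pair eid eS)) (pair eid (rfind (comp eH (pair eid eS)))),
    fun Y m k hk hmin => ?_⟩
  set t := trajectory init query step Y with ht
  choose u hu huB using hS Y m
  have hT : ∀ j, run Y (comp eH (pair eid eS)) (Nat.pair m j) =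
      Part.some ((!halt m (t j)).toNat, u j) := by
    intro j
    simp [run, hid, hu, hH, ht]
  have hOut : run Y (comp eO (pair eid eS)) (Nat.pair m k) =
      Part.some ((out m (t k)).toNat, u k) := by
    simp [run, hid, hu, hO, ht]
  have hfind : k ∈ Nat.rfind fun j => (run Y (comp eH (pair eid eS)) (Nat.pair m j)).map
      fun r => decide (r.1 = 0) := by
    refine Nat.mem_rfind.2 ⟨?_, fun {j} hj => ?_⟩
    · simp [hT, hk]
    · simp [hT, hmin j hj]
  have hloop : ∀ n, n ≤ k + 1 → ∃ w,
      w ∈ (Nat.rec (Part.some 0)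
        (fun j IH => IH.bind fun u => (run Y (comp eH (pair eid eS)) (Nat.pair m j)).bind
          fun r => Part.some (max u r.2)) n : Part ℕ) ∧
      ∀ B, (∀ j < k, query (t j) < B) → w ≤ B := by
    intro n
    induction n with
    | zero => exact fun _ => ⟨0, Part.mem_some _, fun B _ => Nat.zero_le B⟩
    | succ n ih =>
      intro hn
      obtain ⟨w, hw, hwB⟩ := ih (by omega)
      refine ⟨max w (u n), Part.mem_bind_iff.2 ⟨w, hw, ?_⟩, fun B h => ?_⟩
      · rw [hT]
        simp
      · exact max_le (hwB B h) (huB n B fun j hj => h j (by omega))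
  obtain ⟨w, hw, hwB⟩ := hloop (k + 1) le_rfl
  refine ⟨max w (u k), ?_, fun B h => max_le (hwB B h) (huB k B h)⟩
  have hr : (k, w) ∈ run Y (rfind (comp eH (pair eid eS))) m :=
    Part.mem_bind_iff.2 ⟨k, hfind, Part.mem_bind_iff.2 ⟨w, hw, Part.mem_some _⟩⟩
  have hp : (Nat.pair m k, w) ∈ run Y (pair eid (rfind (comp eH (pair eid eS)))) m := by
    refine Part.mem_bind_iff.2 ⟨(m, 0), by rw [hid]; exact Part.mem_some _,
      Part.mem_bind_iff.2 ⟨_, hr, by simp⟩⟩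
  exact Part.mem_bind_iff.2 ⟨_, hp, Part.mem_bind_iff.2
    ⟨((out m (t k)).toNat, u k), by rw [hOut]; exact Part.mem_some _, Part.mem_some _⟩⟩

end OracleCode

/-! ### Canonical prefix codes and their concatenation -/

namespace BlockCode

/-- The position where the current block starts, when a block that starts at `i` ends at
`N i` and the next one starts at `N i + 1`. -/
def blockStart (N : ℕ → ℕ) : ℕ → ℕ
  | 0 => 0
  | n + 1 => if N (blockStart N n) = n then n + 1 else blockStart N n

/-- The position `n` is the end of a block. -/
def IsEnd (N : ℕ → ℕ) (n : ℕ) : Prop := N (blockStart N n) = n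

instance (N : ℕ → ℕ) : DecidablePred (IsEnd N) := fun n =>
  inferInstanceAs (Decidable (N (blockStart N n) = n))

/-- The offset, at level `N - k`, of the code word that has rank `r` among the `c N` words of level
`N` in the canonical code with `c m` words of level `m`. The offset at level `m` is the difference
between the number with the bits read so far as its binary digits and the least number that is not
an extension of a code word of a lower level; so the word is complete when its offset is less than
`c m`. -/
def offset (c : ℕ → ℕ) (N r : ℕ) : ℕ → ℕ
  | 0 => r
  | k + 1 => c (N - (k + 1)) + offset c N r k / 2

/-- The total weight, in units of level `n`, of the code words of levels below `n`. -/
def weightBelow (c : ℕ → ℕ) : ℕ → ℕ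
  | 0 => 0
  | n + 1 => 2 * (weightBelow c n + c n)

/-- One step of the decoder. A state `(n, i, d, p)` consists of the current level `n`, the start
`i` of the current block, the offset `d` of the bits read in this block and the number `p` of bits
read so far. If `d` is less than the number `cnt i n` of code words of level `n`, then a word is
complete, and no bit is read. -/
def decodeStep (cnt : ℕ → ℕ → ℕ) (s : ℕ × ℕ × ℕ × ℕ) (b : Bool) : ℕ × ℕ × ℕ × ℕ :=
  if s.2.2.1 < cnt s.2.1 s.1 then (s.1 + 1, s.1 + 1, 0, s.2.2.2)
  else (s.1 + 1, s.2.1, 2 * (s.2.2.1 - cnt s.2.1 s.1) + b.toNat, s.2.2.2 + 1)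

/-- The states of the decoder that reads `Y`. -/
def decoder (cnt : ℕ → ℕ → ℕ) (Y : ℕ → Bool) : ℕ → ℕ × ℕ × ℕ × ℕ :=
  OracleCode.trajectory (0, 0, 0, 0) (fun s => s.2.2.2) (decodeStep cnt) Y

theorem primrec_decodeStep {cnt : ℕ → ℕ → ℕ} (h : Primrec₂ cnt) : Primrec₂ (decodeStep cnt) := by
  have hn : Primrec fun x : (ℕ × ℕ × ℕ × ℕ) × Bool => x.1.1 := Primrec.fst.comp Primrec.fst
  have hi : Primrec fun x : (ℕ × ℕ × ℕ × ℕ) × Bool => x.1.2.1 :=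
    Primrec.fst.comp (Primrec.snd.comp Primrec.fst)
  have hd : Primrec fun x : (ℕ × ℕ × ℕ × ℕ) × Bool => x.1.2.2.1 :=
    Primrec.fst.comp (Primrec.snd.comp (Primrec.snd.comp Primrec.fst))
  have hp : Primrec fun x : (ℕ × ℕ × ℕ × ℕ) × Bool => x.1.2.2.2 :=
    Primrec.snd.comp (Primrec.snd.comp (Primrec.snd.comp Primrec.fst))
  have hb : Primrec fun x : (ℕ × ℕ × ℕ × ℕ) × Bool => x.2.toNat :=
    (Primrec.dom_bool Bool.toNat).comp Primrec.snd
  have hc : Primrec fun x : (ℕ × ℕ × ℕ × ℕ) × Bool => cnt x.1.2.1 x.1.1 := h.comp hi hn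
  have hn' := Primrec.succ.comp hn
  exact Primrec.ite (Primrec.nat_lt.comp hd hc)
    (hn'.pair (hn'.pair ((Primrec.const 0).pair hp)))
    (hn'.pair (hi.pair ((Primrec.nat_add.comp (Primrec.nat_double.comp
      (Primrec.nat_sub.comp hd hc)) hb).pair (Primrec.succ.comp hp))))

theorem weightBelow_eq_sum (c : ℕ → ℕ) (n : ℕ) :
    weightBelow c n = ∑ m ∈ Finset.range n, c m * 2 ^ (n - m) := by
  induction n with
  | zero => rfl
  | succ n ih =>
    rw [weightBelow, ih, Finset.sum_range_succ, mul_add, Finset.mul_sum]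
    congr 1
    · refine Finset.sum_congr rfl fun m hm => ?_
      have : n + 1 - m = (n - m) + 1 := by
        have := Finset.mem_range.1 hm
        omega
      rw [this, pow_succ]
      ring
    · simp [mul_comm]

variable {N : ℕ → ℕ}

theorem le_blockEnd (hN : ∀ i, i < N i) (n : ℕ) : n ≤ N (blockStart N n) := by
  induction n with
  | zero => exact Nat.zero_le _
  | succ n ih =>
    rw [blockStart]
    split
    · exact (hN _).le
    · omega

theorem blockStart_eq_of_le {n : ℕ} (k : ℕ)
    (h : n + k ≤ N (blockStart N n)) : blockStart N (n + k) = blockStart N n := by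
  induction k with
  | zero => rfl
  | succ k ih =>
    have := ih (by omega)
    rw [← add_assoc, blockStart, if_neg (by rw [this]; omega), this]

theorem exists_isEnd_ge (hN : ∀ i, i < N i) (n : ℕ) : ∃ m ≥ n, IsEnd N m := by
  have h := le_blockEnd hN n
  refine ⟨N (blockStart N n), h, ?_⟩
  have := blockStart_eq_of_le (N := N) (n := n) (N (blockStart N n) - n) (by omega)
  rw [Nat.add_sub_cancel' h] at this
  rw [IsEnd, this]

theorem infinite_isEnd (hN : ∀ i, i < N i) : {n | IsEnd N n}.Infinite :=
  Set.infinite_of_not_bddAbove fun ⟨b, hb⟩ => by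
    obtain ⟨m, hm, hend⟩ := exists_isEnd_ge hN (b + 1)
    have := hb hend
    omega

theorem count_not_add_count (p : ℕ → Prop) [DecidablePred p] (n : ℕ) :
    Nat.count (fun m => ¬ p m) n + Nat.count p n = n := by
  induction n with
  | zero => simp
  | succ n ih =>
    rw [Nat.count_succ, Nat.count_succ]
    by_cases h : p n <;> simp [h] <;> omega

/-- The Kraft inequality bounds offsets on the way back from a code word to its root. -/
theorem offset_add_weightBelow_lt {c : ℕ → ℕ} {M i r : ℕ} (hr : r < c M)
    (kraft : (weightBelow c M + c M) * 2 ^ i < 2 ^ M) (k : ℕ) (hk : k ≤ M) :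
    (offset c M r k + weightBelow c (M - k)) * 2 ^ i < 2 ^ (M - k) := by
  induction k with
  | zero =>
    refine lt_of_le_of_lt (Nat.mul_le_mul_right _ ?_) kraft
    simp only [offset, Nat.sub_zero]
    omega
  | succ k ih =>
    have h := ih (by omega)
    have hsub : M - k = (M - (k + 1)) + 1 := by omega
    rw [hsub, weightBelow, pow_succ] at h
    rw [offset]
    have h2 : 2 * ((c (M - (k + 1)) + offset c M r k / 2 + weightBelow c (M - (k + 1))) * 2 ^ i) ≤
        (offset c M r k + 2 * (weightBelow c (M - (k + 1)) + c (M - (k + 1)))) * 2 ^ i := by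
      rw [← mul_assoc]
      exact Nat.mul_le_mul_right _ (by omega)
    omega

/-- A block starts with offset `0`, as no bits have been read there. -/
theorem offset_root_eq_zero {c : ℕ → ℕ} {M i r : ℕ} (hr : r < c M)
    (kraft : (weightBelow c M + c M) * 2 ^ i < 2 ^ M) (hi : i ≤ M) :
    offset c M r (M - i) = 0 := by
  have h := offset_add_weightBelow_lt hr kraft (M - i) (by omega)
  rw [Nat.sub_sub_self hi] at h
  by_contra hne
  have : 1 * 2 ^ i ≤ (offset c M r (M - i) + weightBelow c i) * 2 ^ i :=
    Nat.mul_le_mul_right _ (by omega)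
  omega

/-- If the code words for the blocks satisfy the Kraft inequality, then some oracle makes the
decoder complete a word exactly at the ends of blocks, each time the word of the prescribed rank.
At level `n`, it has read one bit for each level below `n` that is not the end of a block. -/
theorem exists_decoder_eq {cnt : ℕ → ℕ → ℕ} {r : ℕ → ℕ}
    (kraft : ∀ i n, (weightBelow (cnt i) n + cnt i n) * 2 ^ i < 2 ^ n)
    (hr : ∀ i, r i < cnt i (N i)) (hN : ∀ i, i < N i) :
    ∃ Y, ∀ n, ∃ d,
      decoder cnt Y n = (n, blockStart N n, d, Nat.count (fun m => ¬ IsEnd N m) n) ∧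
      (IsEnd N n → d = r (blockStart N n)) ∧
      (d < cnt (blockStart N n) n ↔ IsEnd N n) := by
  classical
  let d : ℕ → ℕ := fun n =>
    offset (cnt (blockStart N n)) (N (blockStart N n)) (r (blockStart N n))
      (N (blockStart N n) - n)
  have hend : ∀ n, IsEnd N n → d n = r (blockStart N n) := by
    intro n h
    have h' : N (blockStart N n) - n = 0 := by
      rw [IsEnd] at h
      omega
    simp only [d, h', offset]
  have hnot : ∀ n, ¬ IsEnd N n → blockStart N (n + 1) = blockStart N n ∧
      d n = cnt (blockStart N n) n + d (n + 1) / 2 := by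
    intro n h
    have h1 : blockStart N (n + 1) = blockStart N n := if_neg h
    have h2 := le_blockEnd hN n
    have h3 : N (blockStart N n) - n = (N (blockStart N n) - (n + 1)) + 1 := by
      rw [IsEnd] at h
      omega
    have h4 : N (blockStart N n) - (N (blockStart N n) - (n + 1) + 1) = n := by omega
    refine ⟨h1, ?_⟩
    simp only [d, h1]
    rw [h3, offset, h4]
  have hroot : ∀ n, blockStart N n = n → d n = 0 := by
    intro n h
    simp only [d, h]
    exact offset_root_eq_zero (hr n) (kraft n (N n)) (hN n).le
  -- the bit that is read at level `n` is the parity of the next offset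
  refine ⟨fun p => decide (d (Nat.nth (fun m => ¬ IsEnd N m) p + 1) % 2 = 1), fun n => ⟨d n, ?_,
    hend n, ?_⟩⟩
  · induction n with
    | zero => simp [decoder, OracleCode.trajectory, blockStart, hroot 0 rfl]
    | succ n ih =>
      rw [decoder, OracleCode.trajectory, ← decoder, ih, decodeStep]
      by_cases h : IsEnd N n
      · have h1 : d n < cnt (blockStart N n) n := by
          have := hr (blockStart N n)
          rw [show N (blockStart N n) = n from h] at this
          rwa [hend n h]
        have h2 : blockStart N (n + 1) = n + 1 := if_pos h
        simp only [h1, if_true]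
        rw [h2, hroot _ h2, Nat.count_succ, if_neg (not_not.2 h), add_zero]
      · obtain ⟨h1, h2⟩ := hnot n h
        have h3 : ¬ d n < cnt (blockStart N n) n := by omega
        simp only [h3, if_false]
        rw [h1, Nat.count_succ, if_pos h, Nat.nth_count (p := fun m => ¬ IsEnd N m) h]
        have h4 : (decide (d (n + 1) % 2 = 1)).toNat = d (n + 1) % 2 := by
          rcases Nat.mod_two_eq_zero_or_one (d (n + 1)) with h | h <;> simp [h]
        rw [h4, show 2 * (d n - cnt (blockStart N n) n) + d (n + 1) % 2 = d (n + 1) by omega]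
  · constructor
    · intro h
      by_contra hcon
      have := (hnot n hcon).2
      omega
    · intro h
      have := hr (blockStart N n)
      rw [show N (blockStart N n) = n from h] at this
      rwa [hend n h]

end BlockCode

/-! ### Codes for the members of a Martin-Löf test -/

/-- `n` is the first stage at which an initial segment of `Z` of length at most `n` has been
enumerated into the `i`-th set by the stage relation `R`. As only segments of length at most `n`
count, this depends on `Z ↾ n` alone. -/
def EntersAt (R : ℕ → ℕ × List Bool → Prop) (i n : ℕ) (Z : ℕ → Bool) : Prop :=
  (∃ m ≤ n, R n (i, restr Z m)) ∧ ∀ k < n, ¬ ∃ m ≤ k, R k (i, restr Z m)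

section EntersAt

variable {R : ℕ → ℕ × List Bool → Prop}

theorem EntersAt.congr {i n : ℕ} {Z Z' : ℕ → Bool} (h : EntersAt R i n Z)
    (hZ : restr Z n = restr Z' n) : EntersAt R i n Z' := by
  have hm : ∀ m ≤ n, restr Z m = restr Z' m := by
    intro m hm
    rw [← take_restr Z hm, ← take_restr Z' hm, hZ]
  refine ⟨?_, fun k hk => ?_⟩
  · obtain ⟨m, hmn, hR⟩ := h.1
    exact ⟨m, hmn, hm m hmn ▸ hR⟩
  · rintro ⟨m, hmk, hR⟩
    exact h.2 k hk ⟨m, hmk, by rw [hm m (by omega)]; exact hR⟩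

theorem EntersAt.unique {i n n' : ℕ} {Z : ℕ → Bool} (h : EntersAt R i n Z)
    (h' : EntersAt R i n' Z) : n = n' := by
  rcases lt_trichotomy n n' with hlt | heq | hlt
  · exact absurd h.1 (h'.2 n hlt)
  · exact heq
  · exact absurd h'.1 (h.2 n' hlt)

theorem exists_entersAt (hmono : ∀ s t a, s ≤ t → R s a → R t a) {U : ℕ → Set (List Bool)}
    (hU : ∀ a : ℕ × List Bool, a.2 ∈ U a.1 ↔ ∃ s, R s a) {i : ℕ} {Z : ℕ → Bool}
    (hZ : Z ∈ openOf (U i)) : ∃ n, EntersAt R i n Z := by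
  classical
  obtain ⟨m, hm⟩ := hZ
  obtain ⟨s, hs⟩ := (hU (i, restr Z m)).1 hm
  have hex : ∃ n, ∃ m ≤ n, R n (i, restr Z m) :=
    ⟨max m s, m, le_max_left _ _, hmono _ _ _ (le_max_right _ _) hs⟩
  exact ⟨Nat.find hex, Nat.find_spec hex, fun k hk => Nat.find_min hex hk⟩

theorem EntersAt.mem_openOf {U : ℕ → Set (List Bool)}
    (hU : ∀ a : ℕ × List Bool, a.2 ∈ U a.1 ↔ ∃ s, R s a) {i n : ℕ} {Z : ℕ → Bool}
    (h : EntersAt R i n Z) : Z ∈ openOf (U i) := by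
  obtain ⟨m, -, hR⟩ := h.1
  exact ⟨m, (hU (i, restr Z m)).2 ⟨n, hR⟩⟩

theorem primrec_testBit : Primrec₂ Nat.testBit := by
  have hpow : Primrec₂ ((· ^ ·) : ℕ → ℕ → ℕ) := Primrec₂.unpaired'.1 Nat.Primrec.pow
  have : Primrec₂ fun v j : ℕ => decide (v / 2 ^ j % 2 = 1) :=
    (Primrec.eq.comp (Primrec.nat_mod.comp (Primrec.nat_div.comp Primrec.fst
      (hpow.comp (Primrec.const 2) Primrec.snd)) (Primrec.const 2)) (Primrec.const 1)).decide
  exact this.of_eq fun v j => Nat.testBit_eq_decide_div_mod_eq.symm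

open Classical in
/-- The words of length `n`, as binary expansions of numbers below `2 ^ n`, that enter the `i`-th
set at stage `n`. -/
noncomputable def newWords (R : ℕ → ℕ × List Bool → Prop) (i n : ℕ) : List ℕ :=
  (List.range (2 ^ n)).filter fun v => EntersAt R i n v.testBit

theorem primrec_newWords (hR : PrimrecRel R) : Primrec₂ (newWords R) := by
  classical
  have hpow : Primrec₂ ((· ^ ·) : ℕ → ℕ → ℕ) := Primrec₂.unpaired'.1 Nat.Primrec.pow
  have hrestr : Primrec₂ fun v m : ℕ => restr v.testBit m :=
    Primrec.list_map (Primrec.list_range.comp Primrec.snd)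
      (primrec_testBit.comp (Primrec.fst.comp Primrec.fst) Primrec.snd)
  have h1 : PrimrecRel fun (m : ℕ) (y : ℕ × ℕ × ℕ) => R y.2.1 (y.1, restr y.2.2.testBit m) :=
    hR.comp (Primrec.fst.comp (Primrec.snd.comp Primrec.snd))
      ((Primrec.fst.comp Primrec.snd).pair (hrestr.comp
        (Primrec.snd.comp (Primrec.snd.comp Primrec.snd)) Primrec.fst))
  have h2 : PrimrecPred fun y : ℕ × ℕ × ℕ => ∃ m ≤ y.2.1, R y.2.1 (y.1, restr y.2.2.testBit m) :=
    (h1.exists_mem_list.comp (Primrec.list_range.comp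
      (Primrec.succ.comp (Primrec.fst.comp Primrec.snd))) Primrec.id).of_eq fun y => by
        simp
  have h3 : PrimrecRel fun (k : ℕ) (y : ℕ × ℕ × ℕ) =>
      ¬ ∃ m ≤ k, R k (y.1, restr y.2.2.testBit m) :=
    (h2.comp ((Primrec.fst.comp Primrec.snd).pair
      (Primrec.fst.pair (Primrec.snd.comp (Primrec.snd.comp Primrec.snd))))).not
  have h4 : PrimrecRel fun (v : ℕ) (y : ℕ × ℕ) => EntersAt R y.1 y.2 v.testBit := by
    have harg : Primrec fun x : ℕ × (ℕ × ℕ) => (x.2.1, x.2.2, x.1) :=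
      (Primrec.fst.comp Primrec.snd).pair ((Primrec.snd.comp Primrec.snd).pair Primrec.fst)
    refine (h2.comp harg).and (((h3.forall_mem_list.comp (Primrec.list_range.comp
      (Primrec.snd.comp Primrec.snd)) harg)).of_eq fun x => ?_)
    simp
  refine ((h4.listFilter).comp (Primrec.list_range.comp (hpow.comp (Primrec.const 2) Primrec.snd))
    Primrec.id).of_eq fun x => ?_
  simp only [newWords, id]

theorem mem_newWords {i n v : ℕ} :
    v ∈ newWords R i n ↔ v < 2 ^ n ∧ EntersAt R i n v.testBit := by
  simp [newWords]

/-- The Kraft inequality for the words entering the `i`-th set of a test. -/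
theorem kraft_newWords
    {U : ℕ → Set (List Bool)} (hU : ∀ a : ℕ × List Bool, a.2 ∈ U a.1 ↔ ∃ s, R s a) {i : ℕ}
    (hμ : coinMeasure (openOf (U i)) < (2 : ℝ≥0∞)⁻¹ ^ i) (n : ℕ) :
    (BlockCode.weightBelow (fun m => (newWords R i m).length) n + (newWords R i n).length) * 2 ^ i
      < 2 ^ n := by
  classical
  let I : Finset (Σ _ : ℕ, ℕ) :=
    (Finset.range (n + 1)).sigma fun m => (newWords R i m).toFinset
  let C : (Σ _ : ℕ, ℕ) → Set (ℕ → Bool) := fun x => cylinderOf (restr x.2.testBit x.1)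
  have hmem : ∀ x ∈ I, ∀ Z ∈ C x, x.2 < 2 ^ x.1 ∧ EntersAt R i x.1 Z ∧
      ∀ j < x.1, Z j = x.2.testBit j := by
    intro x hx Z hZ
    have h1 := mem_newWords.1 (List.mem_toFinset.1 (Finset.mem_sigma.1 hx).2)
    rw [mem_cylinderOf, length_restr] at hZ
    exact ⟨h1.1, h1.2.congr hZ.symm, restr_eq_restr_iff.1 hZ⟩
  have hdisj : (I : Set (Σ _ : ℕ, ℕ)).PairwiseDisjoint C := by
    intro x hx y hy hne
    refine Set.disjoint_left.2 fun Z hZx hZy => hne ?_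
    obtain ⟨hx1, hx2, hx3⟩ := hmem x hx Z hZx
    obtain ⟨hy1, hy2, hy3⟩ := hmem y hy Z hZy
    obtain ⟨m, v⟩ := x
    obtain ⟨m', v'⟩ := y
    obtain rfl : m = m' := hx2.unique hy2
    have : v = v' := by
      refine Nat.eq_of_testBit_eq fun j => ?_
      by_cases hj : j < m
      · rw [← hx3 j hj, ← hy3 j hj]
      · have hpow : 2 ^ m ≤ 2 ^ j := Nat.pow_le_pow_right (by norm_num) (by omega)
        rw [Nat.testBit_lt_two_pow (hx1.trans_le hpow), Nat.testBit_lt_two_pow (hy1.trans_le hpow)]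
    rw [this]
  have hsum : ∑ m ∈ Finset.range (n + 1), ((newWords R i m).length : ℝ≥0∞) * (2 : ℝ≥0∞)⁻¹ ^ m
      < (2 : ℝ≥0∞)⁻¹ ^ i := by
    refine lt_of_le_of_lt ?_ hμ
    have h1 : coinMeasure (⋃ x ∈ I, C x) ≤ coinMeasure (openOf (U i)) := by
      refine measure_mono (Set.iUnion₂_subset fun x hx Z hZ => ?_)
      exact (hmem x hx Z hZ).2.1.mem_openOf hU
    rw [measure_biUnion_finset hdisj fun x _ => measurableSet_cylinderOf _,
      Finset.sum_sigma] at h1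
    refine le_trans (le_of_eq (Finset.sum_congr rfl fun m _ => ?_)) h1
    have hnd : (newWords R i m).Nodup := List.Nodup.filter _ List.nodup_range
    simp only [C, coinMeasure_cylinderOf, length_restr, Finset.sum_const, nsmul_eq_mul,
      List.toFinset_card_of_nodup hnd]
  have hnat : BlockCode.weightBelow (fun m => (newWords R i m).length) n + (newWords R i n).length
      = ∑ m ∈ Finset.range (n + 1), (newWords R i m).length * 2 ^ (n - m) := by
    rw [Finset.sum_range_succ, BlockCode.weightBelow_eq_sum]
    simp
  have h2 : ((∑ m ∈ Finset.range (n + 1), (newWords R i m).length * 2 ^ (n - m) : ℕ) : ℝ≥0∞) =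
      2 ^ n * ∑ m ∈ Finset.range (n + 1),
        ((newWords R i m).length : ℝ≥0∞) * (2 : ℝ≥0∞)⁻¹ ^ m := by
    push_cast
    rw [Finset.mul_sum]
    refine Finset.sum_congr rfl fun m hm => ?_
    have hmn : m ≤ n := Nat.lt_succ_iff.1 (Finset.mem_range.1 hm)
    have h3 : (2 : ℝ≥0∞) ^ n * (2 : ℝ≥0∞)⁻¹ ^ m = 2 ^ (n - m) := by
      conv_lhs => rw [← Nat.sub_add_cancel hmn, pow_add, mul_assoc, ← mul_pow,
        ENNReal.mul_inv_cancel (by norm_num) (by norm_num), one_pow, mul_one]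
    rw [← h3]
    ring
  -- the inequality between measures, multiplied by `2 ^ n * 2 ^ i`
  have h4 : ((∑ m ∈ Finset.range (n + 1), (newWords R i m).length * 2 ^ (n - m) : ℕ) : ℝ≥0∞) *
      2 ^ i < 2 ^ n := by
    rw [h2, mul_assoc]
    have h5 : (∑ m ∈ Finset.range (n + 1),
        ((newWords R i m).length : ℝ≥0∞) * (2 : ℝ≥0∞)⁻¹ ^ m) * 2 ^ i < 1 := by
      refine (ENNReal.mul_lt_mul_left (by simp) (by simp) hsum).trans_eq ?_
      rw [← mul_pow, ENNReal.inv_mul_cancel (by norm_num) (by norm_num), one_pow]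
    exact (ENNReal.mul_lt_mul_right (by simp) (by simp) h5).trans_eq (mul_one _)
  rw [hnat]
  exact_mod_cast h4

/-- If `X` enters the `i`-th set at stage `n`, then its initial segment is one of the words. -/
theorem EntersAt.exists_rank
    {i n : ℕ} {X : ℕ → Bool} (h : EntersAt R i n X) :
    ∃ (r v : ℕ), (newWords R i n)[r]? = some v ∧ ∀ j < n, v.testBit j = X j := by
  have hbits : ∀ j < n, (Nat.ofBits fun j : Fin n => X j).testBit j = X j := fun j hj =>
    Nat.testBit_ofBits_lt _ j hj
  have hv : (Nat.ofBits fun j : Fin n => X j) ∈ newWords R i n :=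
    mem_newWords.2 ⟨Nat.ofBits_lt_two_pow _, h.congr (restr_eq_restr_iff.2 fun j hj =>
      (hbits j hj).symm)⟩
  obtain ⟨r, hr⟩ := List.mem_iff_getElem?.1 hv
  exact ⟨r, _, hr, hbits⟩

end EntersAt

/-! ### Compressing the use for nonrandom reals -/

/-- A real that is captured by a test has the concatenated codes of its blocks as an oracle. -/
theorem exists_compressing_program {X : ℕ → Bool} (hX : ¬ MartinLofRandom X) :
    ∃ (Y : ℕ → Bool) (e : OracleCode) (u : ℕ → ℕ), e.ComputesWithUse Y X u ∧
      ∀ c : ℕ, ∃ n, prefixUse u n + c < n := by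
  classical
  simp only [MartinLofRandom, not_forall, not_not] at hX
  obtain ⟨U, hU, hXU⟩ := hX
  obtain ⟨R, hR, hmono, hspec⟩ := hU.uniformly_ce.exists_primrecRel
  have henter : ∀ i, ∃ n, EntersAt R i n X := fun i =>
    exists_entersAt hmono hspec (Set.mem_iInter.1 hXU i)
  choose N hN using henter
  choose r v hr hv using fun i => (hN i).exists_rank
  let cnt : ℕ → ℕ → ℕ := fun i n => (newWords R i n).length
  have hcnt : Primrec₂ cnt := Primrec.list_length.comp₂ (primrec_newWords hR)
  have kraft : ∀ i n, (BlockCode.weightBelow (cnt i) n + cnt i n) * 2 ^ i < 2 ^ n := fun i n =>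
    kraft_newWords hspec (hU.measure_lt i) n
  have hrlt : ∀ i, r i < cnt i (N i) := fun i => (List.getElem?_eq_some_iff.1 (hr i)).1
  have hNlt : ∀ i, i < N i := by
    intro i
    refine (Nat.pow_lt_pow_iff_right (a := 2) (by norm_num)).1 (lt_of_le_of_lt ?_ (kraft i (N i)))
    have := hrlt i
    exact Nat.le_mul_of_pos_left _ (by omega)
  obtain ⟨Y, hY⟩ := BlockCode.exists_decoder_eq kraft hrlt hNlt
  choose d hdec hdr hdlt using hY
  -- the program for digit `m` waits for the first complete word longer than `m` and reads off its
  -- digit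
  have hinit : ∀ s b, OracleCode.trajectory (0, 0, 0, 0) (fun s => s.2.2.2)
    (BlockCode.decodeStep cnt) s b = BlockCode.decoder cnt s b := fun _ _ => rfl
  have hs1 : Primrec fun x : ℕ × (ℕ × ℕ × ℕ × ℕ) => x.2.1 := Primrec.fst.comp Primrec.snd
  have hs2 : Primrec fun x : ℕ × (ℕ × ℕ × ℕ × ℕ) => x.2.2.1 :=
    Primrec.fst.comp (Primrec.snd.comp Primrec.snd)
  have hs3 : Primrec fun x : ℕ × (ℕ × ℕ × ℕ × ℕ) => x.2.2.2.1 :=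
    Primrec.fst.comp (Primrec.snd.comp (Primrec.snd.comp Primrec.snd))
  have hhalt : Primrec₂ fun (m : ℕ) (s : ℕ × ℕ × ℕ × ℕ) =>
      decide (m < s.1 ∧ s.2.2.1 < cnt s.2.1 s.1) :=
    ((Primrec.nat_lt.comp Primrec.fst hs1).and
      (Primrec.nat_lt.comp hs3 (hcnt.comp hs2 hs1))).decide
  have hout : Primrec₂ fun (m : ℕ) (s : ℕ × ℕ × ℕ × ℕ) =>
      (((newWords R s.2.1 s.1)[s.2.2.1]?).getD 0).testBit m :=
    primrec_testBit.comp (Primrec.option_getD.comp (Primrec.list_getElem?.comp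
      ((primrec_newWords hR).comp hs2 hs1) hs3) (Primrec.const 0)) Primrec.fst
  obtain ⟨e, he⟩ := OracleCode.exists_run_of_machine (0, 0, 0, 0)
    (query := fun s : ℕ × ℕ × ℕ × ℕ => s.2.2.2)
    (Primrec.snd.comp (Primrec.snd.comp Primrec.snd)) (BlockCode.primrec_decodeStep hcnt)
    hhalt hout
  simp only [hinit, decide_eq_true_eq, decide_eq_false_iff_not] at he
  have huse : ∀ m, ∃ u, ((X m).toNat, u) ∈ OracleCode.run Y e m ∧ ∀ n, m < n →
      BlockCode.IsEnd N n → u ≤ Nat.count (fun j => ¬ BlockCode.IsEnd N j) n + 1 := by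
    intro m
    have hex : ∃ k, m < k ∧ BlockCode.IsEnd N k := BlockCode.exists_isEnd_ge hNlt (m + 1)
    obtain ⟨hmk, hend⟩ := Nat.find_spec hex
    obtain ⟨u, hu, hB⟩ := he Y m (Nat.find hex) (by simp only [hdec, hdlt]; exact ⟨hmk, hend⟩)
      (fun j hj => by simp only [hdec, hdlt]; exact Nat.find_min hex hj)
    refine ⟨u, ?_, fun n hmn hn => hB _ fun j hj => ?_⟩
    · generalize Nat.find hex = k at hmk hend hu
      have hk : N (BlockCode.blockStart N k) = k := hend
      have h1 := hr (BlockCode.blockStart N k)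
      have h2 := hv (BlockCode.blockStart N k) m (by rwa [hk])
      rw [hk] at h1
      simpa [hdec, hdr k hend, h1, h2] using hu
    · have : Nat.find hex ≤ n := Nat.find_min' hex ⟨hmn, hn⟩
      simp only [hdec]
      exact Nat.lt_succ_of_le (Nat.count_monotone _ (by omega))
  choose u hu hub using huse
  refine ⟨Y, e, u, hu, fun c => ?_⟩
  -- at the end of a block with `c + 2` predecessors, `c + 2` bits have been saved
  have hinf := BlockCode.infinite_isEnd hNlt
  refine ⟨Nat.nth (BlockCode.IsEnd N) (c + 2), ?_⟩
  have hend : BlockCode.IsEnd N (Nat.nth (BlockCode.IsEnd N) (c + 2)) :=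
    Nat.nth_mem_of_infinite hinf _
  have hcount := BlockCode.count_not_add_count (BlockCode.IsEnd N)
    (Nat.nth (BlockCode.IsEnd N) (c + 2))
  rw [Nat.count_nth_of_infinite hinf] at hcount
  have hle : prefixUse u (Nat.nth (BlockCode.IsEnd N) (c + 2)) ≤
      Nat.count (fun j => ¬ BlockCode.IsEnd N j) (Nat.nth (BlockCode.IsEnd N) (c + 2)) + 1 :=
    Finset.sup_le fun m hm => hub m _ (Finset.mem_range.1 hm) hend
  omega

theorem martinLofRandom_iff_exists_le_prefixUse (X : ℕ → Bool) :
    MartinLofRandom X ↔ ∀ (Y : ℕ → Bool) (e : OracleCode) (u : ℕ → ℕ),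
      e.ComputesWithUse Y X u → ∃ c : ℕ, ∀ n : ℕ, (n : ℤ) - (c : ℤ) ≤ (prefixUse u n : ℤ) := by
  refine ⟨fun hX Y e u hu => hX.exists_le_prefixUse hu, fun h => ?_⟩
  by_contra hX
  obtain ⟨Y, e, u, hu, hsave⟩ := exists_compressing_program hX
  obtain ⟨c, hc⟩ := h Y e u hu
  obtain ⟨n, hn⟩ := hsave c
  have := hc n
  omega

theorem kobayashiIncompressible_iff_exists_le_prefixUse (X : ℕ → Bool) :
    KobayashiIncompressible X ↔ ∀ (Y : ℕ → Bool) (e : OracleCode) (u : ℕ → ℕ),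
      e.ComputesWithUse Y X u → ∃ c : ℕ, ∀ n : ℕ, (n : ℤ) - (c : ℤ) ≤ (prefixUse u n : ℤ) := by
  constructor
  · intro h Y e u hu
    by_contra! hcon
    refine h (prefixUse u) ?_ ⟨Y, e, u, hu, fun n => le_rfl⟩
    rintro ⟨b, hb⟩
    obtain ⟨n, hn⟩ := hcon b.toNat
    have := hb ⟨n, rfl⟩
    dsimp only at this
    omega
  · rintro h f hf ⟨Y, e, u, hu, hle⟩
    obtain ⟨c, hc⟩ := h Y e u hu
    refine hf ⟨c, ?_⟩
    rintro _ ⟨n, rfl⟩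
    have h1 := hc n
    have h2 := hle n
    dsimp only
    omega

theorem mainTheorem1 (X : ℕ → Bool) :
    (MartinLofRandom X ↔ KobayashiIncompressible X) ∧
    (MartinLofRandom X ↔
      ∀ Y : ℕ → Bool,
        TuringReducible (fun n => Part.some (X n).toNat) (fun n => Part.some (Y n).toNat) →
        ∀ (e : OracleCode) (u : ℕ → ℕ), e.ComputesWithUse Y X u →
          ∃ c : ℕ, ∀ n : ℕ, (n : ℤ) - (c : ℤ) ≤ (prefixUse u n : ℤ)) := by
  refine ⟨(martinLofRandom_iff_exists_le_prefixUse X).trans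
    (kobayashiIncompressible_iff_exists_le_prefixUse X).symm, ?_⟩
  refine (martinLofRandom_iff_exists_le_prefixUse X).trans ⟨fun h Y _ => h Y, ?_⟩
  exact fun h Y e u hu => h Y ((OracleCode.turingReducible_iff X Y).2 ⟨e, u, hu⟩) e u hu
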